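/- Let $d\ge 1$, let $\|\cdot\|$ denote the Euclidean norm on $\mathbb{R}^d$ and the norm $\|M\|=\bigl(\sum_{i,j}|M_{i,j}|^2\bigr)^{1/2}$ on the space $\mathcal{M}_d(\mathbb{R})$ of real $d\times d$ matrices. Let $F:\mathbb{R}^d\to\mathbb{R}$ be of class $\mathcal{C}^3$ and such that: (i) $\nabla F$ is globally Lipschitz continuous; (ii) for some $\mu\in(0,\infty)$ one has $\langle\nabla F(x_2)-\nabla F(x_1),x_2-x_1\rangle\ge\mu\|x_2-x_1\|^2$ for all $x_1,x_2\in\mathbb{R}^d$; (iii) the third order derivative of $F$ is bounded. Then $F$ has a unique minimizer, denoted by $x^\star$. Let $\sigma:[0,\infty)\times\mathbb{R}^d\to\mathcal{M}_d(\mathbb{R})$ be continuous, and assume that there is a bounded function $\varsigma:[0,\infty)\to[0,\infty)$ such that for all $t\ge 0$ one has \[ \|\sigma(t,x_2)-\sigma(t,x_1)\|\le\varsigma(t)\|x_2-x_1\|\quad\forall x_1,x_2\in\mathbb{R}^d,\qquad \sup_{x\in\mathbb{R}^d}\frac{\|\sigma(t,x)\|}{1+\|x-x^\star\|}\le\varsigma(t).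 \] Let $(\gamma_n)_{n\ge 1}$ be independent standard centered Gaussian random variables with values in $\mathbb{R}^d$. For $h>0$ and a deterministic $x_0\in\mathbb{R}^d$ define \[ X_0=x_0,\qquad X_{n+1}=X_n-h\nabla F(X_n)+h\,\sigma(nh,X_n)\gamma_{n+1},\quad n\ge 0. \] For $\varphi:\mathbb{R}^d\to\mathbb{R}$ of class $\mathcal{C}^2$ set \[ |\!|\!|\varphi|\!|\!|_2=\sup_{x\in\mathbb{R}^d}\ \sup_{k_1,k_2\in\mathbb{R}^d\setminus\{0\}}\frac{|D^2\varphi(x).(k_1,k_2)|}{\|k_1\|\|k_2\|}. \] Let $h_{\max}>0$. There exist $H\in(0,h_{\max})$ and $C\in(0,\infty)$ such that for any $\varphi:\mathbb{R}^d\to\mathbb{R}$ of class $\mathcal{C}^2$ with bounded second order derivative, any $x_0\in\mathbb{R}^d$, any integer $N\ge 1$ and any $h\in(0,H)$, the random variable $\varphi(X_N)$ is integrable and \[ \bigl|\mathbb{E}[\varphi(X_N)]-\varphi(x^\star)\bigr|\le C\bigl(\|\nabla\varphi(x^\star)\|+|\!|\!|\varphi|\!|\!|_2\bigr)\bigl(1+\|x_0-x^\star\|^3\bigr)\bigl(e^{-\mu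 Nh}+h\bigr). \] -/

import Mathlib

open MeasureTheory ProbabilityTheory Set
open scoped Gradient

namespace SGD

/-- The Euclidean space `ℝ^d` with its standard inner product and norm. -/
abbrev E (d : ℕ) : Type := EuclideanSpace ℝ (Fin d)

/-- The norm `(∑ i j, |M i j|^2)^(1/2)` on square matrices. -/
noncomputable def matNorm {d : ℕ} (M : Matrix (Fin d) (Fin d) ℝ) : ℝ :=
  √(∑ i, ∑ j, |M i j| ^ 2)

/-- The product of a matrix with a vector of the Euclidean space. -/
noncomputable def matVec {d : ℕ} (M : Matrix (Fin d) (Fin d) ℝ) (v : E d) : E d :=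
  WithLp.toLp 2 (M.mulVec (WithLp.ofLp v))

/-- The objective function is of class `C^3`, has a globally Lipschitz gradient, is `μ`-convex with
`μ > 0`, and has a bounded third order derivative. -/
structure ObjectiveAssumption {d : ℕ} (F : E d → ℝ) (μ : ℝ) : Prop where
  contDiff : ContDiff ℝ 3 F
  lipschitz : ∃ L : ℝ, 0 < L ∧ ∀ x₁ x₂ : E d, ‖∇ F x₂ - ∇ F x₁‖ ≤ L * ‖x₂ - x₁‖
  mu_pos : 0 < μ
  mu_convex : ∀ x₁ x₂ : E d, inner ℝ (∇ F x₂ - ∇ F x₁) (x₂ - x₁) ≥ μ * ‖x₂ - x₁‖ ^ 2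
  bounded_third : ∃ M : ℝ, ∀ x : E d, ‖iteratedFDeriv ℝ 3 F x‖ ≤ M

/-- The diffusion coefficient is continuous on `[0,∞) × ℝ^d`; for every time `t ≥ 0` it is globally
Lipschitz and of at most linear growth around `xs`, with a constant `ς t`, and `ς` is bounded.
Only the values at times `t ≥ 0` matter. -/
structure DiffusionAssumption {d : ℕ} (σ : ℝ → E d → Matrix (Fin d) (Fin d) ℝ) (xs : E d) :
    Prop where
  continuousOn : ContinuousOn (fun p : ℝ × E d => σ p.1 p.2) (Ici (0 : ℝ) ×ˢ univ)
  exists_bound : ∃ ς : ℝ → ℝ,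
    (∀ t, 0 ≤ t → 0 ≤ ς t) ∧
    (∀ t, 0 ≤ t → ∀ x₁ x₂ : E d, matNorm (σ t x₂ - σ t x₁) ≤ ς t * ‖x₂ - x₁‖) ∧
    (∀ t, 0 ≤ t → ∀ x : E d, matNorm (σ t x) / (1 + ‖x - xs‖) ≤ ς t) ∧
    (∃ K : ℝ, ∀ t, 0 ≤ t → ς t ≤ K)

/-- The scheme `X (n+1) = X n - h ∇F(X n) + h σ(t n, X n) γ (n+1)`, `X 0 = x₀`, with `t n = n h`. -/
noncomputable def scheme {d : ℕ} {Ω : Type*} (F : E d → ℝ)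
    (σ : ℝ → E d → Matrix (Fin d) (Fin d) ℝ) (γ : ℕ → Ω → E d) (h : ℝ) (x₀ : E d) :
    ℕ → Ω → E d
  | 0, _ => x₀
  | n + 1, ω =>
    scheme F σ γ h x₀ n ω - h • ∇ F (scheme F σ γ h x₀ n ω)
      + h • matVec (σ (n * h) (scheme F σ γ h x₀ n ω)) (γ (n + 1) ω)

/-- The supremum over `x` of the operator norm of the differential of order `m` of `φ` at `x`,
that is, of the least `c` such that `|D^m φ(x).(k₁,…,k_m)| ≤ c ‖k₁‖ ⋯ ‖k_m‖` for all directions.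
It is meaningful when these norms are bounded in `x`. -/
noncomputable def tripleNorm {d : ℕ} (m : ℕ) (φ : E d → ℝ) : ℝ :=
  ⨆ x : E d, ‖iteratedFDeriv ℝ m φ x‖

end SGD

namespace SGD

/-! ### Taylor's inequality -/

section Calculus

variable {V G : Type*} [NormedAddCommGroup V] [NormedSpace ℝ V]
  [NormedAddCommGroup G] [NormedSpace ℝ G]

/-! A Taylor expansion of the test function at the minimizer, where the law of the scheme
concentrates, bounds the weak error by the mean `m n = ‖E[X n - xs]‖` and the second moment `a n =
E‖X n - xs‖ ^ 2`, with weights `‖∇ φ xs‖` and `tripleNorm 2 φ`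
(`integrable_and_abs_integral_sub_le`). No equation for the evolution of `φ` is needed.

Both moments obey scalar recursions, because the new noise is centered and independent of the past.
Strong convexity gives `a (n+1) ≤ (1 - 2μh + O(h²)) a n + O(h²)` (`second_moment_step`). Linearizing
`∇ F` at `xs`, where it vanishes, gives `m (n+1) ≤ (1 - μh) m n + h M a n` (`mean_step`); the
symmetry of the Hessian yields the sharp factor.

Since `a` contracts strictly faster than `m`, for small `h` a combination `m + c a` contracts at
rate `1 - μh` up to an error `O(h²)` per step (`add_mul_le_of_recursion`). Summing gives `exp (-μNh)
+ O(h)` without a spurious factor `Nh` in front of the exponential. -/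

lemma norm_taylor_one_le {f : V → G} (hf : ContDiff ℝ 2 f) {K : ℝ}
    (hK : ∀ x, ‖iteratedFDeriv ℝ 2 f x‖ ≤ K) (x y : V) :
    ‖f y - f x - fderiv ℝ f x (y - x)‖ ≤ K * ‖y - x‖ ^ 2 := by
  have hK0 : 0 ≤ K := (norm_nonneg _).trans (hK x)
  have hd : Differentiable ℝ (fderiv ℝ f) :=
    (hf.fderiv_right (m := 1) (by norm_num)).differentiable (by norm_num)
  have hlip : ∀ z, ‖fderiv ℝ f z - fderiv ℝ f x‖ ≤ K * ‖z - x‖ := fun z =>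
    Convex.norm_image_sub_le_of_norm_fderiv_le (fun w _ => hd w)
      (fun w _ => by
        have := hK w
        rwa [← norm_iteratedFDeriv_fderiv, norm_iteratedFDeriv_one] at this)
      convex_univ (mem_univ x) (mem_univ z)
  have hball : ∀ w ∈ Metric.closedBall x ‖y - x‖,
      ‖fderiv ℝ f w - fderiv ℝ f x‖ ≤ K * ‖y - x‖ := fun w hw =>
    (hlip w).trans (mul_le_mul_of_nonneg_left (by simpa [dist_eq_norm] using hw) hK0)
  -- The mean value inequality on the ball loses the factor `1/2` of Taylor's formula, which only
  -- affects constants.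
  have h := Convex.norm_image_sub_le_of_norm_fderiv_le'
    (fun w _ => hf.differentiable (by norm_num) w) hball (convex_closedBall _ _)
    (Metric.mem_closedBall_self (norm_nonneg _)) (y := y) (by simp [dist_eq_norm])
  rwa [mul_assoc, ← sq] at h

end Calculus

/-! ### Contraction for a symmetric linear drift -/

section Hilbert

variable {V : Type*} [NormedAddCommGroup V] [InnerProductSpace ℝ V]

/-- One step of the gradient descent for a quadratic form contracts with the optimal rate. -/
lemma norm_sub_smul_apply_le {A : V →L[ℝ] V} (hA : ∀ u v, inner ℝ (A u) v = inner ℝ u (A v))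
    {μ L h : ℝ} (hμ : ∀ v, μ * ‖v‖ ^ 2 ≤ inner ℝ (A v) v) (hL : ‖A‖ ≤ L) (hh : 0 ≤ h)
    (hhL : h * (L + μ) ≤ 2) (hhμ : h * μ ≤ 1) (v : V) :
    ‖v - h • A v‖ ≤ (1 - μ * h) * ‖v‖ := by
  set T : V →L[ℝ] V := ContinuousLinearMap.id ℝ V - h • A with hT
  have hTv : ∀ u, T u = u - h • A u := fun u => by simp [hT]
  have hsymm : T.IsSymmetric := fun u w => by
    simp only [ContinuousLinearMap.coe_coe, hTv, inner_sub_left, inner_sub_right,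
      real_inner_smul_left, real_inner_smul_right, hA]
  have hnorm : ‖T‖ ≤ 1 - μ * h := by
    -- The Rayleigh quotients of `T` lie in `[1 - hL, 1 - hμ]`, and `hhL` says exactly that `-(1 -
    -- μh) ≤ 1 - hL`. At `x = 0` the quotient is `0 / 0 = 0`, which is where `hhμ` enters.
    rw [ContinuousLinearMap.norm_eq_iSup_rayleighQuotient T hsymm]
    refine ciSup_le fun x => ?_
    have h1 : T.reApplyInnerSelf x = ‖x‖ ^ 2 - h * inner ℝ (A x) x := by
      simp [ContinuousLinearMap.reApplyInnerSelf, hTv, inner_sub_left, real_inner_smul_left]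
    have h2 : inner ℝ (A x) x ≤ L * ‖x‖ ^ 2 := by
      have := real_inner_le_norm (A x) x
      have := A.le_opNorm x
      have : ‖A‖ * ‖x‖ ≤ L * ‖x‖ := by gcongr
      nlinarith [norm_nonneg x]
    rcases eq_or_ne x 0 with rfl | hx
    · simp only [ContinuousLinearMap.rayleighQuotient, norm_zero]
      norm_num
      linarith
    have hpos : 0 < ‖x‖ ^ 2 := by positivity
    rw [ContinuousLinearMap.rayleighQuotient, abs_div, abs_of_pos hpos, div_le_iff₀ hpos, h1,
      abs_le]
    have h3 := mul_le_mul_of_nonneg_left h2 hh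
    have h4 := mul_le_mul_of_nonneg_left (hμ x) hh
    constructor <;> nlinarith
  rw [← hTv]
  exact (T.le_opNorm v).trans (by gcongr)

end Hilbert

/-! ### Matrices acting on Euclidean space -/

section Matrix

variable {d : ℕ}

lemma matNorm_nonneg (M : Matrix (Fin d) (Fin d) ℝ) : 0 ≤ matNorm M := Real.sqrt_nonneg _

lemma matNorm_transpose (M : Matrix (Fin d) (Fin d) ℝ) : matNorm M.transpose = matNorm M := by
  unfold matNorm
  rw [Finset.sum_comm]
  rfl

lemma norm_matVec_le (M : Matrix (Fin d) (Fin d) ℝ) (v : E d) :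
    ‖matVec M v‖ ≤ matNorm M * ‖v‖ := by
  rw [EuclideanSpace.norm_eq, EuclideanSpace.norm_eq, matNorm, ← Real.sqrt_mul (by positivity)]
  apply Real.sqrt_le_sqrt
  rw [Finset.sum_mul]
  refine Finset.sum_le_sum fun i _ => ?_
  simp only [matVec, Matrix.mulVec, dotProduct, Real.norm_eq_abs, sq_abs]
  exact Finset.sum_mul_sq_le_sq_mul_sq _ _ _

lemma inner_matVec (M : Matrix (Fin d) (Fin d) ℝ) (u v : E d) :
    inner ℝ u (matVec M v) = inner ℝ (matVec M.transpose u) v := by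
  simp only [EuclideanSpace.inner_eq_star_dotProduct, matVec, star_trivial]
  rw [Matrix.mulVec_transpose, dotProduct_comm, Matrix.dotProduct_mulVec, dotProduct_comm]

lemma continuous_matVec {X : Type*} [TopologicalSpace X] {S : X → Matrix (Fin d) (Fin d) ℝ}
    {v : X → E d} (hS : Continuous S) (hv : Continuous v) :
    Continuous fun x => matVec (S x) (v x) := by
  unfold matVec
  exact (PiLp.continuous_toLp 2 _).comp
    (hS.matrix_mulVec ((PiLp.continuous_ofLp 2 _).comp hv))

end Matrix

/-! ### Strongly convex objectives: minimizer and Hessian -/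

section Objective

variable {d : ℕ} {F : E d → ℝ} {μ : ℝ}

lemma ObjectiveAssumption.differentiable (hF : ObjectiveAssumption F μ) : Differentiable ℝ F :=
  hF.contDiff.differentiable (by norm_num)

lemma ObjectiveAssumption.contDiff_gradient (hF : ObjectiveAssumption F μ) :
    ContDiff ℝ 2 (∇ F) :=
  (InnerProductSpace.toDual ℝ (E d)).symm.contDiff.comp
    (hF.contDiff.fderiv_right (m := 2) (by norm_num))

lemma ObjectiveAssumption.norm_iteratedFDeriv_gradient (x : E d) :
    ‖iteratedFDeriv ℝ 2 (∇ F) x‖ = ‖iteratedFDeriv ℝ 3 F x‖ := by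
  rw [← norm_iteratedFDeriv_fderiv (f := F)]
  exact LinearIsometryEquiv.norm_iteratedFDeriv_comp_left
    (InnerProductSpace.toDual ℝ (E d)).symm (fderiv ℝ F) x 2

/-- The quadratic lower bound satisfied by a `μ`-convex function. -/
lemma ObjectiveAssumption.le_of_convex (hF : ObjectiveAssumption F μ) (x y : E d) :
    F x + inner ℝ (∇ F x) (y - x) + μ / 2 * ‖y - x‖ ^ 2 ≤ F y := by
  -- `F` along the segment, minus its tangent and the expected parabola; `μ`-convexity makes `k`
  -- nondecreasing, and the claim is `k 0 ≤ k 1`.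
  set k : ℝ → ℝ := fun t =>
    F (x + t • (y - x)) - t * inner ℝ (∇ F x) (y - x) - μ / 2 * t ^ 2 * ‖y - x‖ ^ 2 with hk
  have hder : ∀ t, HasDerivAt k (inner ℝ (∇ F (x + t • (y - x))) (y - x)
      - inner ℝ (∇ F x) (y - x) - μ * t * ‖y - x‖ ^ 2) t := by
    intro t
    have h1 : HasDerivAt (fun t : ℝ => x + t • (y - x)) (y - x) t := by
      simpa using ((hasDerivAt_id t).smul_const (y - x)).const_add x
    have h2 := (hF.differentiable (x + t • (y - x))).hasFDerivAt.comp_hasDerivAt t h1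
    have h3 := (hasDerivAt_id t).mul_const (inner ℝ (∇ F x) (y - x))
    have h4 := (((hasDerivAt_id t).pow 2).const_mul (μ / 2)).mul_const (‖y - x‖ ^ 2)
    refine ((h2.sub h3).sub h4).congr_deriv ?_
    simp only [inner_gradient_left, id, Nat.cast_ofNat]
    ring
  have hmono : MonotoneOn k (Icc 0 1) := by
    refine monotoneOn_of_deriv_nonneg (convex_Icc 0 1)
      (fun t _ => (hder t).continuousAt.continuousWithinAt)
      (fun t _ => (hder t).differentiableAt.differentiableWithinAt) fun t ht => ?_
    rw [interior_Icc] at ht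
    rw [(hder t).deriv]
    have h5 := hF.mu_convex x (x + t • (y - x))
    rw [add_sub_cancel_left, real_inner_smul_right, norm_smul, mul_pow, Real.norm_eq_abs,
      sq_abs, inner_sub_left] at h5
    have ht0 := ht.1
    refine le_of_mul_le_mul_left ?_ ht0
    nlinarith
  have h01 := hmono (left_mem_Icc.2 zero_le_one) (right_mem_Icc.2 zero_le_one) zero_le_one
  simp [hk] at h01
  rw [inner_gradient_left, map_sub]
  linarith

/-- The quadratic lower bound at `0` gives `F 0 ≤ F y` as soon as `‖y‖ ≥ 2 / μ * ‖∇ F 0‖`, so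
compactness of balls suffices. -/
lemma ObjectiveAssumption.exists_minimizer (hF : ObjectiveAssumption F μ) :
    ∃ xs : E d, ∀ y, F xs ≤ F y := by
  refine hF.contDiff.continuous.exists_forall_le' (0 : E d) ?_
  filter_upwards [(tendsto_norm_cocompact_atTop (E := E d)).eventually_ge_atTop
    (2 / μ * ‖∇ F 0‖)] with y hy
  have h1 := hF.le_of_convex 0 y
  have h2 := (abs_le.1 (abs_real_inner_le_norm (∇ F 0) (y - 0))).1
  rw [sub_zero] at h1 h2
  have h3 : ‖∇ F 0‖ ≤ μ / 2 * ‖y‖ := by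
    have := hF.mu_pos
    calc _ = μ / 2 * (2 / μ * ‖∇ F 0‖) := by field_simp
      _ ≤ _ := by gcongr
  nlinarith [norm_nonneg y]

lemma gradient_eq_zero_of_forall_le {xs : E d} (hxs : ∀ y, F xs ≤ F y) : ∇ F xs = 0 := by
  have : IsLocalMin F xs := Filter.Eventually.of_forall hxs
  rw [gradient, this.fderiv_eq_zero, map_zero]

lemma ObjectiveAssumption.existsUnique_minimizer (hF : ObjectiveAssumption F μ) :
    ∃! xs : E d, ∀ y, F xs ≤ F y := by
  obtain ⟨xs, hxs⟩ := hF.exists_minimizer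
  refine ⟨xs, hxs, fun y hy => ?_⟩
  have h := hF.mu_convex xs y
  rw [gradient_eq_zero_of_forall_le hxs, gradient_eq_zero_of_forall_le hy] at h
  simp only [sub_zero, inner_zero_left] at h
  have h' : ‖y - xs‖ ^ 2 ≤ 0 := by
    have := hF.mu_pos
    by_contra! hc
    nlinarith [mul_pos this hc]
  exact sub_eq_zero.1 (norm_eq_zero.1 (pow_eq_zero_iff two_ne_zero |>.1
    (le_antisymm h' (sq_nonneg _))))

/-- Through the Riesz isometry this is the symmetry of the second derivative of `F`. -/
lemma ObjectiveAssumption.inner_fderiv_gradient_symm (hF : ObjectiveAssumption F μ) (x u v : E d) :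
    inner ℝ (fderiv ℝ (∇ F) x u) v = inner ℝ u (fderiv ℝ (∇ F) x v) := by
  have key : ∀ u v, inner ℝ (fderiv ℝ (∇ F) x u) v = fderiv ℝ (fderiv ℝ F) x u v := by
    intro u v
    have hd : HasFDerivAt (∇ F) (fderiv ℝ (∇ F) x) x :=
      (hF.contDiff_gradient.differentiable (by norm_num) x).hasFDerivAt
    have h2 := ((InnerProductSpace.toDual ℝ (E d)).toContinuousLinearEquiv.toContinuousLinearMap
      |>.hasFDerivAt (x := ∇ F x)).comp x hd
    have h3 : (fderiv ℝ F) = (InnerProductSpace.toDual ℝ (E d)) ∘ ∇ F :=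
      toDual_comp_gradient.symm
    rw [h3]
    erw [h2.fderiv]
    rfl
  rw [real_inner_comm _ u, key, key]
  exact (hF.contDiff.contDiffAt.isSymmSndFDerivAt (by simp; norm_num)) u v

/-- Limit of `mu_convex` along the difference quotients from `x` to `x + t • v`, as `t → 0⁺`. -/
lemma ObjectiveAssumption.le_inner_fderiv_gradient (hF : ObjectiveAssumption F μ) (x v : E d) :
    μ * ‖v‖ ^ 2 ≤ inner ℝ (fderiv ℝ (∇ F) x v) v := by
  have hd : HasFDerivAt (∇ F) (fderiv ℝ (∇ F) x) x :=
    (hF.contDiff_gradient.differentiable (by norm_num) x).hasFDerivAt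
  have hlim := (hd.hasLineDerivAt v).tendsto_slope_zero_right
  have hlim2 := hlim.inner (𝕜 := ℝ) (tendsto_const_nhds (x := v))
  refine ge_of_tendsto hlim2 ?_
  filter_upwards [self_mem_nhdsWithin] with t ht
  have ht : 0 < t := ht
  have h5 := hF.mu_convex x (x + t • v)
  rw [add_sub_cancel_left, real_inner_smul_right, norm_smul, mul_pow, Real.norm_eq_abs,
    sq_abs] at h5
  rw [real_inner_smul_left, inv_mul_eq_div, le_div_iff₀ ht]
  refine le_of_mul_le_mul_left ?_ ht
  nlinarith

lemma norm_fderiv_gradient_le {L : ℝ} (hL : 0 ≤ L)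
    (h : ∀ x₁ x₂ : E d, ‖∇ F x₂ - ∇ F x₁‖ ≤ L * ‖x₂ - x₁‖) (x : E d) :
    ‖fderiv ℝ (∇ F) x‖ ≤ L :=
  norm_fderiv_le_of_lip' ℝ hL (Filter.Eventually.of_forall fun y => h x y)

end Objective

end SGD
namespace SGD

/-! ### Moments after one step -/

section Step

variable {d : ℕ} {Ω : Type*} [MeasurableSpace Ω] {P : Measure Ω}

/-- Transposing the matrix puts everything that depends on `X` on one side of the inner product;
independence then factors the expectation, and `g` is centered. The dominating `f` only serves
integrability. -/
lemma integral_inner_matVec_eq_zero [IsFiniteMeasure P] {X g : Ω → E d}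
    (hX : AEMeasurable X P) (hind : IndepFun X g P) (hg : Integrable g P) (hg0 : ∫ ω, g ω ∂P = 0)
    {S : E d → Matrix (Fin d) (Fin d) ℝ} (hS : Continuous S) {v : E d → E d} (hv : Continuous v)
    {f : Ω → ℝ} (hf : Integrable f P) (hSv : ∀ ω, matNorm (S (X ω)) * ‖v (X ω)‖ ≤ f ω) :
    Integrable (fun ω => inner ℝ (v (X ω)) (matVec (S (X ω)) (g ω))) P ∧
      ∫ ω, inner ℝ (v (X ω)) (matVec (S (X ω)) (g ω)) ∂P = 0 := by
  have hw : Continuous fun x => matVec (S x).transpose (v x) :=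
    continuous_matVec hS.matrix_transpose hv
  have hwi : Integrable (fun ω => matVec (S (X ω)).transpose (v (X ω))) P := by
    refine hf.mono' (hw.measurable.comp_aemeasurable hX).aestronglyMeasurable (.of_forall fun ω => ?_)
    refine (norm_matVec_le _ _).trans ?_
    rw [matNorm_transpose]
    exact hSv ω
  have hind' : IndepFun (fun ω => matVec (S (X ω)).transpose (v (X ω))) g P :=
    hind.comp hw.measurable measurable_id
  simp only [inner_matVec]
  refine ⟨hind'.integrable_bilin hwi hg (innerSL ℝ), ?_⟩
  have := hind'.integral_bilin hwi hg (innerSL ℝ)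
  rw [hg0, map_zero] at this
  exact this

/-- One step of the scheme: contraction of the second moment of the distance to the critical point
`xs` of the drift. -/
lemma second_moment_step [IsProbabilityMeasure P] {b : E d → E d} (hb : Continuous b)
    {S : E d → Matrix (Fin d) (Fin d) ℝ} (hS : Continuous S) {xs : E d}
    {μ L K G h : ℝ} (hh : 0 ≤ h)
    (hbL : ∀ x, ‖b x‖ ≤ L * ‖x - xs‖) (hbμ : ∀ x, μ * ‖x - xs‖ ^ 2 ≤ inner ℝ (b x) (x - xs))
    (hSK : ∀ x, matNorm (S x) ≤ K * (1 + ‖x - xs‖))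
    {X g : Ω → E d} (hX : MemLp (fun ω => X ω - xs) 2 P) (hind : IndepFun X g P)
    (hg : MemLp g 2 P) (hg0 : ∫ ω, g ω ∂P = 0) (hgG : ∫ ω, ‖g ω‖ ^ 2 ∂P = G)
    {X' : Ω → E d} (hX' : X' = fun ω => X ω - h • b (X ω) + h • matVec (S (X ω)) (g ω)) :
    MemLp (fun ω => X' ω - xs) 2 P ∧
    ∫ ω, ‖X' ω - xs‖ ^ 2 ∂P ≤
      (1 - 2 * μ * h + h ^ 2 * (L ^ 2 + 2 * K ^ 2 * G)) * ∫ ω, ‖X ω - xs‖ ^ 2 ∂P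
        + 2 * K ^ 2 * G * h ^ 2 := by
  have hXm : AEMeasurable X P := by
    simpa using (hX.aestronglyMeasurable.aemeasurable.add_const xs)
  have hgm : AEMeasurable g P := hg.aestronglyMeasurable.aemeasurable
  have hg1 : Integrable g P := hg.integrable (by norm_num)
  have hX2 : Integrable (fun ω => ‖X ω - xs‖ ^ 2) P := hX.integrable_norm_pow (by norm_num)
  have hg2 : Integrable (fun ω => ‖g ω‖ ^ 2) P := hg.integrable_norm_pow (by norm_num)
  have hT : Continuous fun p : E d × E d => p.1 - h • b p.1 + h • matVec (S p.1) p.2 :=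
    (continuous_fst.sub ((hb.comp continuous_fst).const_smul h)).add
      ((continuous_matVec (hS.comp continuous_fst) continuous_snd).const_smul h)
  have hX'm : AEMeasurable X' P := by
    rw [hX']
    exact hT.measurable.comp_aemeasurable (hXm.prodMk hgm)
  set v : E d → E d := fun x => x - h • b x - xs with hv
  have hvc : Continuous v := (continuous_id.sub (hb.const_smul h)).sub continuous_const
  -- Majorant of `matNorm (S x) ^ 2`, from `(1 + r)² ≤ 2 (1 + r²)`.
  set w : E d → ℝ := fun x => 2 * K ^ 2 * (1 + ‖x - xs‖ ^ 2) with hw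
  have hwi : Integrable (fun ω => w (X ω)) P := ((integrable_const 1).add hX2).const_mul _
  have hS2 : ∀ x, matNorm (S x) ^ 2 ≤ w x := fun x => by
    have h1 := pow_le_pow_left₀ (matNorm_nonneg (S x)) (hSK x) 2
    have h2 := mul_nonneg (sq_nonneg K) (sq_nonneg (1 - ‖x - xs‖))
    simp only [hw]
    nlinarith
  have hv2 : ∀ x, ‖v x‖ ^ 2 ≤ (1 - 2 * μ * h + h ^ 2 * L ^ 2) * ‖x - xs‖ ^ 2 := fun x => by
    have h1 : v x = (x - xs) - h • b x := by simp only [hv]; abel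
    rw [h1, norm_sub_sq_real, real_inner_smul_right, norm_smul, mul_pow, Real.norm_eq_abs, sq_abs,
      real_inner_comm]
    have h2 := pow_le_pow_left₀ (norm_nonneg (b x)) (hbL x) 2
    have h3 := mul_le_mul_of_nonneg_left h2 (sq_nonneg h)
    have h4 := mul_le_mul_of_nonneg_left (hbμ x) hh
    nlinarith
  have hwc : Continuous w := by fun_prop
  have hwm : Measurable w := hwc.measurable
  have hwgi : Integrable (fun ω => w (X ω) * ‖g ω‖ ^ 2) P := by
    exact (hind.comp hwm (measurable_norm.pow_const 2)).integrable_mul hwi hg2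
  have hwg : ∫ ω, w (X ω) * ‖g ω‖ ^ 2 ∂P = 2 * K ^ 2 * (1 + ∫ ω, ‖X ω - xs‖ ^ 2 ∂P) * G := by
    have := (hind.comp hwm (measurable_norm.pow_const 2)).integral_fun_mul_eq_mul_integral
      hwi.aestronglyMeasurable hg2.aestronglyMeasurable
    simp only [Function.comp_apply] at this
    rw [this, hgG]
    simp only [hw]
    rw [integral_const_mul, integral_add (integrable_const 1) hX2]
    simp
  have hSg : ∀ ω, ‖matVec (S (X ω)) (g ω)‖ ^ 2 ≤ w (X ω) * ‖g ω‖ ^ 2 := fun ω => by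
    refine (pow_le_pow_left₀ (norm_nonneg _) (norm_matVec_le _ _) 2).trans ?_
    rw [mul_pow]
    gcongr
    exact hS2 _
  have hX'v : ∀ ω, X' ω - xs = v (X ω) + h • matVec (S (X ω)) (g ω) := fun ω => by
    simp only [hX', hv]; abel
  have hsq : ∀ ω, ‖X' ω - xs‖ ^ 2 = ‖v (X ω)‖ ^ 2
      + 2 * h * inner ℝ (v (X ω)) (matVec (S (X ω)) (g ω))
      + h ^ 2 * ‖matVec (S (X ω)) (g ω)‖ ^ 2 := fun ω => by
    rw [hX'v, norm_add_sq_real, real_inner_smul_right, norm_smul, mul_pow, Real.norm_eq_abs, sq_abs]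
    ring
  obtain ⟨hcross, hcross0⟩ := integral_inner_matVec_eq_zero hXm hind hg1 hg0 hS hvc
    (f := fun ω => w (X ω) + (1 - 2 * μ * h + h ^ 2 * L ^ 2) * ‖X ω - xs‖ ^ 2)
    (hwi.add (hX2.const_mul _)) (fun ω => by
      have h1 := hS2 (X ω)
      have h2 := hv2 (X ω)
      nlinarith [sq_nonneg (matNorm (S (X ω)) - ‖v (X ω)‖), sq_nonneg (matNorm (S (X ω))),
        sq_nonneg ‖v (X ω)‖])
  -- Integrable majorant of `‖X' - xs‖²` that keeps the cross term exact, since only its integral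
  -- vanishes.
  set f : Ω → ℝ := fun ω => (1 - 2 * μ * h + h ^ 2 * L ^ 2) * ‖X ω - xs‖ ^ 2
    + 2 * h * inner ℝ (v (X ω)) (matVec (S (X ω)) (g ω)) + h ^ 2 * (w (X ω) * ‖g ω‖ ^ 2) with hf
  have hfi : Integrable f P :=
    ((hX2.const_mul _).add (hcross.const_mul _)).add (hwgi.const_mul _)
  have hXf : ∀ ω, ‖X' ω - xs‖ ^ 2 ≤ f ω := fun ω => by
    have h1 := mul_le_mul_of_nonneg_left (hSg ω) (sq_nonneg h)
    rw [hsq]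
    simp only [hf]
    linarith [hv2 (X ω)]
  have hX'a : AEStronglyMeasurable (fun ω => X' ω - xs) P :=
    (hX'm.sub_const xs).aestronglyMeasurable
  have hX'2 : Integrable (fun ω => ‖X' ω - xs‖ ^ 2) P :=
    hfi.mono' (hX'a.norm.pow 2) (.of_forall fun ω => by
      rw [Real.norm_of_nonneg (sq_nonneg _)]; exact hXf ω)
  have hX'L : MemLp (fun ω => X' ω - xs) 2 P := (memLp_two_iff_integrable_sq_norm hX'a).2 hX'2
  refine ⟨hX'L, ?_⟩
  calc ∫ ω, ‖X' ω - xs‖ ^ 2 ∂P ≤ ∫ ω, f ω ∂P := integral_mono hX'2 hfi hXf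
    _ = _ := by
      simp only [hf]
      have hi : Integrable (fun ω => (1 - 2 * μ * h + h ^ 2 * L ^ 2) * ‖X ω - xs‖ ^ 2
          + 2 * h * inner ℝ (v (X ω)) (matVec (S (X ω)) (g ω))) P :=
        (hX2.const_mul _).add (hcross.const_mul _)
      rw [integral_add hi (hwgi.const_mul _),
        integral_add (hX2.const_mul _) (hcross.const_mul _), integral_const_mul,
        integral_const_mul, integral_const_mul, hcross0, hwg]
      ring

/-- One step of the scheme: contraction of the mean of the distance to the critical point `xs` of
the drift, up to the second moment. -/
lemma mean_step [IsProbabilityMeasure P] {b : E d → E d} (hb : Continuous b)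
    {S : E d → Matrix (Fin d) (Fin d) ℝ} (hS : Continuous S) {A : E d →L[ℝ] E d} {xs : E d}
    {μ K M h : ℝ} (hh : 0 ≤ h)
    (hSK : ∀ x, matNorm (S x) ≤ K * (1 + ‖x - xs‖))
    (hbA : ∀ x, ‖b x - A (x - xs)‖ ≤ M * ‖x - xs‖ ^ 2)
    (hA : ∀ v, ‖v - h • A v‖ ≤ (1 - μ * h) * ‖v‖)
    {X g : Ω → E d} (hX : MemLp (fun ω => X ω - xs) 2 P) (hind : IndepFun X g P)
    (hg1 : Integrable g P) (hg0 : ∫ ω, g ω ∂P = 0)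
    {X' : Ω → E d} (hX' : X' = fun ω => X ω - h • b (X ω) + h • matVec (S (X ω)) (g ω))
    (hX'1 : Integrable (fun ω => X' ω - xs) P) :
    ‖∫ ω, X' ω - xs ∂P‖ ≤ (1 - μ * h) * ‖∫ ω, X ω - xs ∂P‖
      + h * M * ∫ ω, ‖X ω - xs‖ ^ 2 ∂P := by
  have hXm : AEMeasurable X P := by
    simpa using (hX.aestronglyMeasurable.aemeasurable.add_const xs)
  have hX1 : Integrable (fun ω => X ω - xs) P := hX.integrable (by norm_num)
  have hX2 : Integrable (fun ω => ‖X ω - xs‖ ^ 2) P := hX.integrable_norm_pow (by norm_num)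
  set r : Ω → E d := fun ω => b (X ω) - A (X ω - xs) with hr
  have hri : Integrable r P := by
    refine (hX2.const_mul M).mono' ?_ (.of_forall fun ω => hbA (X ω))
    exact ((hb.sub (A.continuous.comp
      (continuous_id.sub continuous_const))).measurable.comp_aemeasurable hXm).aestronglyMeasurable
  set z : Ω → E d := fun ω => matVec (S (X ω)) (g ω) with hz
  have hdec : ∀ ω, X' ω - xs = (X ω - xs) - h • A (X ω - xs) - h • r ω + h • z ω := fun ω => by
    simp only [hX', hr, hz, smul_sub]; abel
  have hAi : Integrable (fun ω => A (X ω - xs)) P := A.integrable_comp hX1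
  -- The noise term is the difference of terms already known to be integrable.
  have hzi : Integrable (fun ω => h • z ω) P := by
    refine (((hX'1.sub hX1).add (hAi.smul h)).add (hri.smul h)).congr (.of_forall fun ω => ?_)
    simp only [Pi.add_apply, Pi.sub_apply, Pi.smul_apply, hdec ω]
    abel
  have hz0 : ∫ ω, h • z ω ∂P = 0 := by
    refine ext_inner_left ℝ fun u => ?_
    have h0 := (integral_inner_matVec_eq_zero hXm hind hg1 hg0 hS (v := fun _ => u)
      continuous_const (f := fun ω => K * (1 + ‖X ω - xs‖) * ‖u‖)
      ((((integrable_const 1).add hX1.norm).const_mul _).mul_const _)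
      fun ω => mul_le_mul_of_nonneg_right (hSK _) (norm_nonneg _)).2
    rw [← integral_inner hzi u, inner_zero_right]
    simp only [real_inner_smul_right]
    rw [integral_const_mul, h0, mul_zero]
  have hint : ∫ ω, X' ω - xs ∂P = ((∫ ω, X ω - xs ∂P) - h • A (∫ ω, X ω - xs ∂P))
      - h • ∫ ω, r ω ∂P := by
    have hi1 : Integrable (fun ω => (X ω - xs) - h • A (X ω - xs)) P := hX1.sub (hAi.smul h)
    have hri' : Integrable (fun ω => h • r ω) P := hri.smul h
    have hAi' : Integrable (fun ω => h • A (X ω - xs)) P := hAi.smul h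
    have hi2 : Integrable (fun ω => (X ω - xs) - h • A (X ω - xs) - h • r ω) P := hi1.sub hri'
    rw [integral_congr_ae (.of_forall hdec), integral_add hi2 hzi, hz0, add_zero,
      integral_sub hi1 hri', integral_sub hX1 hAi', integral_smul, integral_smul,
      A.integral_comp_comm hX1]
  have hrn : ‖∫ ω, r ω ∂P‖ ≤ M * ∫ ω, ‖X ω - xs‖ ^ 2 ∂P := by
    rw [← integral_const_mul]
    exact norm_integral_le_of_norm_le (hX2.const_mul M) (.of_forall fun ω => hbA (X ω))
  rw [hint]
  refine (norm_sub_le _ _).trans (add_le_add (hA _) ?_)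
  rw [norm_smul, Real.norm_of_nonneg hh, mul_assoc]
  gcongr

end Step

/-! ### The coupled scalar recursion -/

section Recursion

/-- The linear recursion behind the weak error estimate. -/
lemma add_mul_le_of_recursion {a m : ℕ → ℝ} {μ h M D c : ℝ} (hμ : 0 < μ) (hh : 0 < h)
    (hμh : μ * h ≤ 1) (hD : 0 ≤ D) (hc : 0 ≤ c) (hcM : 2 * M ≤ c * μ) (ha0 : ∀ n, 0 ≤ a n)
    (ha : ∀ n, a (n + 1) ≤ (1 - 3 / 2 * μ * h) * a n + D * h ^ 2)
    (hm : ∀ n, m (n + 1) ≤ (1 - μ * h) * m n + h * M * a n) (h0 : 0 ≤ m 0) (N : ℕ) :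
    m N + c * a N ≤ Real.exp (-μ * N * h) * (m 0 + c * a 0) + c * D / μ * h := by
  have hpow : m N + c * a N ≤ (1 - μ * h) ^ N * (m 0 + c * a 0) + c * D / μ * h := by
    induction N with
    | zero =>
      have : 0 ≤ c * D / μ * h := by positivity
      simpa using this
    | succ n ih =>
      have h1 := mul_le_mul_of_nonneg_left (ha n) hc
      have h2 := mul_le_mul_of_nonneg_left ih (sub_nonneg.2 hμh)
      -- The spare `c * μ * h / 2` in the contraction of `c * a n` absorbs the coupling `h * M * a
      -- n`.
      have h3 := mul_le_mul_of_nonneg_right hcM (mul_nonneg hh.le (ha0 n))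
      -- `c * D / μ * h` is the fixed point of `y ↦ (1 - μ * h) * y + c * D * h ^ 2`.
      have h4 : (1 - μ * h) * (c * D / μ * h) = c * D / μ * h - c * D * h ^ 2 := by
        field_simp
      rw [mul_add ((1 - μ * h)) _ (c * D / μ * h), h4] at h2
      rw [pow_succ' (1 - μ * h) n]
      nlinarith [hm n]
  refine hpow.trans (add_le_add_left ?_ _)
  have hexp : (1 - μ * h) ^ N ≤ Real.exp (-μ * N * h) := by
    have := pow_le_pow_left₀ (sub_nonneg.2 hμh) (Real.one_sub_le_exp_neg (μ * h)) N
    rw [← Real.exp_nat_mul] at this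
    rwa [show (N : ℝ) * -(μ * h) = -μ * N * h by ring] at this
  have := ha0 0
  gcongr

end Recursion

/-! ### Growth of the diffusion and independence from the past -/

section Scheme

variable {d : ℕ}

lemma DiffusionAssumption.continuous {σ : ℝ → E d → Matrix (Fin d) (Fin d) ℝ} {xs : E d}
    (hσ : DiffusionAssumption σ xs) {t : ℝ} (ht : 0 ≤ t) : Continuous (σ t) := by
  have := hσ.continuousOn.comp_continuous (f := fun x : E d => (t, x)) (by fun_prop)
    (fun x => ⟨ht, mem_univ _⟩)
  exact this

lemma DiffusionAssumption.exists_matNorm_le {σ : ℝ → E d → Matrix (Fin d) (Fin d) ℝ} {xs : E d}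
    (hσ : DiffusionAssumption σ xs) :
    ∃ K, 0 ≤ K ∧ ∀ t, 0 ≤ t → ∀ x, matNorm (σ t x) ≤ K * (1 + ‖x - xs‖) := by
  obtain ⟨ς, h0, -, h2, K, hK⟩ := hσ.exists_bound
  refine ⟨K, (h0 0 le_rfl).trans (hK 0 le_rfl), fun t ht x => ?_⟩
  have := (h2 t ht x).trans (hK t ht)
  rwa [div_le_iff₀ (by positivity)] at this

/-- The scheme at step `n` is a measurable function of the first `n` noises. -/
lemma exists_measurable_scheme_eq {Ω : Type*} {F : E d → ℝ} {σ : ℝ → E d → Matrix (Fin d) (Fin d) ℝ}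
    (hF : Continuous (∇ F)) (hσ : ∀ t, 0 ≤ t → Continuous (σ t)) (γ : ℕ → Ω → E d) {h : ℝ}
    (hh : 0 ≤ h) (x₀ : E d) (n : ℕ) :
    ∃ f : (Finset.range n → E d) → E d, Measurable f ∧
      scheme F σ γ h x₀ n = fun ω => f fun i => γ (i + 1) ω := by
  induction n with
  | zero => exact ⟨fun _ => x₀, measurable_const, rfl⟩
  | succ n ih =>
    obtain ⟨f, hf, hfe⟩ := ih
    have hT : Continuous fun p : E d × E d =>
        p.1 - h • ∇ F p.1 + h • matVec (σ (n * h) p.1) p.2 :=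
      (continuous_fst.sub ((hF.comp continuous_fst).const_smul h)).add
        ((continuous_matVec ((hσ _ (by positivity)).comp continuous_fst)
          continuous_snd).const_smul h)
    refine ⟨fun u => (fun p : E d × E d =>
        p.1 - h • ∇ F p.1 + h • matVec (σ (n * h) p.1) p.2)
        (f (fun i => u ⟨i, Finset.mem_range.2 ((Finset.mem_range.1 i.2).trans n.lt_succ_self)⟩),
          u ⟨n, Finset.self_mem_range_succ n⟩), ?_, ?_⟩
    · refine hT.measurable.comp ((hf.comp ?_).prodMk (measurable_pi_apply _))
      exact measurable_pi_lambda _ fun i => measurable_pi_apply _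
    · funext ω
      simp only [scheme, hfe]

variable {Ω : Type*} [MeasurableSpace Ω] {P : Measure Ω}

lemma indepFun_scheme {F : E d → ℝ} {σ : ℝ → E d → Matrix (Fin d) (Fin d) ℝ}
    (hF : Continuous (∇ F)) (hσ : ∀ t, 0 ≤ t → Continuous (σ t)) {γ : ℕ → Ω → E d}
    (hγ : ∀ n, AEMeasurable (γ (n + 1)) P) (hind : iIndepFun (fun n : ℕ => γ (n + 1)) P) {h : ℝ}
    (hh : 0 ≤ h) (x₀ : E d) (n : ℕ) :
    IndepFun (scheme F σ γ h x₀ n) (γ (n + 1)) P := by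
  obtain ⟨f, hf, hfe⟩ := exists_measurable_scheme_eq hF hσ γ hh x₀ n
  have h1 := hind.indepFun_finset₀ (Finset.range n) {n} (by simp) hγ
  rw [hfe]
  exact h1.comp hf (measurable_pi_apply (⟨n, Finset.mem_singleton_self n⟩ : ({n} : Finset ℕ)))

end Scheme

end SGD
namespace SGD

/-! ### Moment bounds for the scheme -/

section Moments

variable {d : ℕ} {F : E d → ℝ} {μ : ℝ}

/-- Bounds on the first two moments of the scheme around the minimizer, for small step sizes. -/
lemma exists_moments_bound (hF : ObjectiveAssumption F μ) {xs : E d} (hxs : ∀ y, F xs ≤ F y)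
    {σ : ℝ → E d → Matrix (Fin d) (Fin d) ℝ} (hσ : DiffusionAssumption σ xs) {hmax : ℝ}
    (hmax0 : 0 < hmax) :
    ∃ H c C : ℝ, 0 < H ∧ H < hmax ∧ 1 ≤ c ∧ 0 ≤ C ∧
      ∀ (Ω : Type*) [MeasurableSpace Ω] (P : Measure Ω) [IsProbabilityMeasure P]
        (γ : ℕ → Ω → E d),
        (∀ n : ℕ, HasLaw (γ (n + 1)) (stdGaussian (E d)) P) →
        iIndepFun (fun n : ℕ => γ (n + 1)) P →
      ∀ (x₀ : E d) (N : ℕ) (h : ℝ), 0 < h → h < H →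
        MemLp (fun ω => scheme F σ γ h x₀ N ω - xs) 2 P ∧
        ‖∫ ω, scheme F σ γ h x₀ N ω - xs ∂P‖
            + c * ∫ ω, ‖scheme F σ γ h x₀ N ω - xs‖ ^ 2 ∂P
          ≤ Real.exp (-μ * N * h) * (‖x₀ - xs‖ + c * ‖x₀ - xs‖ ^ 2) + C * h := by
  have hμ := hF.mu_pos
  obtain ⟨L, hL0, hL⟩ := hF.lipschitz
  obtain ⟨M, hM⟩ := hF.bounded_third
  obtain ⟨K, hK0, hK⟩ := hσ.exists_matNorm_le
  have hM0 : 0 ≤ M := (norm_nonneg _).trans (hM 0)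
  have hxs0 := gradient_eq_zero_of_forall_le hxs
  set G : ℝ := ∫ x, ‖x‖ ^ 2 ∂(stdGaussian (E d)) with hG
  have hG0 : 0 ≤ G := integral_nonneg fun x => sq_nonneg _
  set B : ℝ := L ^ 2 + 2 * K ^ 2 * G with hB
  have hB0 : 0 ≤ B := by positivity
  set D : ℝ := 2 * K ^ 2 * G with hD
  have hD0 : 0 ≤ D := by positivity
  -- `2 * M / μ` absorbs the Taylor remainder; the extra `1` ensures `1 ≤ c`, so that `c * a` also
  -- dominates `a`.
  set c : ℝ := 2 * M / μ + 1 with hc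
  have hc1 : 1 ≤ c := by
    have : 0 ≤ 2 * M / μ := by positivity
    linarith
  have hcM : 2 * M ≤ c * μ := by
    rw [hc, add_mul, div_mul_cancel₀ _ hμ.ne']
    linarith
  -- `hmax / 2` keeps `H < hmax`; `1 / (L + μ)` makes the linearized step contract; `μ / (2 * B +
  -- 1)` yields `h ^ 2 * B ≤ μ * h / 2`, turning the rate `2μ` into `3/2 μ`.
  set H : ℝ := min (hmax / 2) (min (1 / (L + μ)) (μ / (2 * B + 1))) with hH
  refine ⟨H, c, c * D / μ, by positivity, (min_le_left _ _).trans_lt (by linarith), hc1,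
    by positivity, ?_⟩
  intro Ω _ P _ γ hγ hind x₀ N h hh hhH
  have hh1 : h * (L + μ) ≤ 1 := by
    rw [← le_div_iff₀ (by positivity)]
    exact hhH.le.trans ((min_le_right _ _).trans (min_le_left _ _))
  have hh2 : h * (2 * B + 1) ≤ μ := by
    rw [← le_div_iff₀ (by positivity)]
    exact hhH.le.trans ((min_le_right _ _).trans (min_le_right _ _))
  have hhμ : h * μ ≤ 1 := by nlinarith [mul_pos hh hL0]
  have hgc : Continuous (∇ F) := hF.contDiff_gradient.continuous
  have hLb : ∀ x, ‖∇ F x‖ ≤ L * ‖x - xs‖ := fun x => by simpa [hxs0] using hL xs x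
  have hmono : ∀ x, μ * ‖x - xs‖ ^ 2 ≤ inner ℝ (∇ F x) (x - xs) := fun x => by
    have := hF.mu_convex xs x
    rwa [hxs0, sub_zero] at this
  have hA : ∀ v, ‖v - h • fderiv ℝ (∇ F) xs v‖ ≤ (1 - μ * h) * ‖v‖ :=
    norm_sub_smul_apply_le (hF.inner_fderiv_gradient_symm xs) (hF.le_inner_fderiv_gradient xs)
      (norm_fderiv_gradient_le hL0.le hL xs) hh.le (by linarith) hhμ
  have htaylor : ∀ x, ‖∇ F x - fderiv ℝ (∇ F) xs (x - xs)‖ ≤ M * ‖x - xs‖ ^ 2 := fun x => by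
    have := norm_taylor_one_le hF.contDiff_gradient (K := M)
      (fun y => (ObjectiveAssumption.norm_iteratedFDeriv_gradient y).trans_le (hM y)) xs x
    rwa [hxs0, sub_zero] at this
  have hσc : ∀ t, 0 ≤ t → Continuous (σ t) := fun t ht => hσ.continuous ht
  have hγ2 : ∀ n, MemLp (γ (n + 1)) 2 P := fun n => by
    have h1 : MemLp id 2 (P.map (γ (n + 1))) := by
      rw [(hγ n).map_eq]
      exact IsGaussian.memLp_two_id
    exact h1.comp_of_map (hγ n).aemeasurable
  have hγ0 : ∀ n, ∫ ω, γ (n + 1) ω ∂P = 0 := fun n => by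
    rw [(hγ n).integral_eq, integral_id_stdGaussian]
  have hγG : ∀ n, ∫ ω, ‖γ (n + 1) ω‖ ^ 2 ∂P = G := fun n =>
    (hγ n).integral_comp (f := fun x => ‖x‖ ^ 2) (by fun_prop)
  have hindn : ∀ n, IndepFun (scheme F σ γ h x₀ n) (γ (n + 1)) P :=
    indepFun_scheme hgc hσc (fun n => (hγ n).aemeasurable) hind hh.le x₀
  have hstep := fun (n : ℕ) (hn : MemLp (fun ω => scheme F σ γ h x₀ n ω - xs) 2 P) =>
    second_moment_step hgc (hσc (n * h) (by positivity)) hh.le hLb hmono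
      (hK (n * h) (by positivity)) hn (hindn n) (hγ2 n) (hγ0 n) (hγG n)
      (X' := scheme F σ γ h x₀ (n + 1)) rfl
  have hmem : ∀ n, MemLp (fun ω => scheme F σ γ h x₀ n ω - xs) 2 P := fun n => by
    induction n with
    | zero => exact memLp_const (x₀ - xs)
    | succ n ih => exact (hstep n ih).1
  refine ⟨hmem N, ?_⟩
  have hrec := add_mul_le_of_recursion (a := fun n => ∫ ω, ‖scheme F σ γ h x₀ n ω - xs‖ ^ 2 ∂P)
    (m := fun n => ‖∫ ω, scheme F σ γ h x₀ n ω - xs ∂P‖) (M := M) hμ hh (by linarith) hD0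
    (by linarith) hcM (fun n => integral_nonneg fun ω => sq_nonneg _)
    (fun n => by
      refine (hstep n (hmem n)).2.trans (add_le_add_left ?_ _)
      refine mul_le_mul_of_nonneg_right ?_ (integral_nonneg fun ω => sq_nonneg _)
      nlinarith)
    (fun n => mean_step hgc (hσc (n * h) (by positivity)) hh.le (hK (n * h) (by positivity))
      htaylor hA (hmem n) (hindn n) ((hγ2 n).integrable (by norm_num)) (hγ0 n)
      (X' := scheme F σ γ h x₀ (n + 1)) rfl ((hmem (n + 1)).integrable (by norm_num)))
    (norm_nonneg _) N
  simpa [scheme] using hrec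

end Moments

/-! ### From moments to test functions -/

section TestFunction

variable {d : ℕ} {Ω : Type*} [MeasurableSpace Ω] {P : Measure Ω} [IsProbabilityMeasure P]

/-- Weak error of a random variable around `xs`, in terms of its first two centered moments. -/
lemma integrable_and_abs_integral_sub_le {φ : E d → ℝ} (hφ : ContDiff ℝ 2 φ)
    (hφb : ∃ M : ℝ, ∀ x, ‖iteratedFDeriv ℝ 2 φ x‖ ≤ M) {xs : E d} {X : Ω → E d}
    (hX : MemLp (fun ω => X ω - xs) 2 P) :
    Integrable (fun ω => φ (X ω)) P ∧
    |(∫ ω, φ (X ω) ∂P) - φ xs| ≤ ‖∇ φ xs‖ * ‖∫ ω, X ω - xs ∂P‖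
      + tripleNorm 2 φ * ∫ ω, ‖X ω - xs‖ ^ 2 ∂P := by
  -- Boundedness is essential here: the real supremum of an unbounded family is `0` by default.
  have hT : ∀ x, ‖iteratedFDeriv ℝ 2 φ x‖ ≤ tripleNorm 2 φ := fun x =>
    le_ciSup (f := fun x => ‖iteratedFDeriv ℝ 2 φ x‖)
      (hφb.imp fun M hM => by rintro _ ⟨y, rfl⟩; exact hM y) x
  set T := tripleNorm 2 φ
  have hX1 : Integrable (fun ω => X ω - xs) P := hX.integrable (by norm_num)
  have hX2 : Integrable (fun ω => ‖X ω - xs‖ ^ 2) P := hX.integrable_norm_pow (by norm_num)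
  have hXm : AEMeasurable X P := by
    simpa using (hX.aestronglyMeasurable.aemeasurable.add_const xs)
  set r : Ω → ℝ := fun ω => φ (X ω) - φ xs - inner ℝ (∇ φ xs) (X ω - xs) with hr
  have hrb : ∀ ω, ‖r ω‖ ≤ T * ‖X ω - xs‖ ^ 2 := fun ω => by
    simp only [hr, inner_gradient_left]
    exact norm_taylor_one_le hφ hT xs (X ω)
  have hrm : AEStronglyMeasurable r P := by
    have : Continuous fun x => φ x - φ xs - inner ℝ (∇ φ xs) (x - xs) := by
      have := hφ.continuous
      fun_prop
    exact (this.measurable.comp_aemeasurable hXm).aestronglyMeasurable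
  have hri : Integrable r P := (hX2.const_mul T).mono' hrm (.of_forall hrb)
  have hli : Integrable (fun ω => inner ℝ (∇ φ xs) (X ω - xs)) P := hX1.const_inner _
  have hdec : ∀ ω, φ (X ω) = φ xs + inner ℝ (∇ φ xs) (X ω - xs) + r ω := fun ω => by
    simp only [hr]; ring
  have hci : Integrable (fun ω => φ xs + inner ℝ (∇ φ xs) (X ω - xs)) P :=
    (integrable_const _).add hli
  refine ⟨(hci.add hri).congr (.of_forall fun ω => (hdec ω).symm), ?_⟩
  have hint : (∫ ω, φ (X ω) ∂P) - φ xs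
      = inner ℝ (∇ φ xs) (∫ ω, X ω - xs ∂P) + ∫ ω, r ω ∂P := by
    rw [integral_congr_ae (.of_forall hdec), integral_add hci hri,
      integral_add (integrable_const _) hli, integral_inner hX1,
      integral_const, probReal_univ, one_smul]
    ring
  rw [hint]
  refine (abs_add_le _ _).trans (add_le_add (abs_real_inner_le_norm _ _) ?_)
  rw [← integral_const_mul]
  exact norm_integral_le_of_norm_le (hX2.const_mul T) (.of_forall hrb)

end TestFunction

end SGD

theorem theorem1 {d : ℕ} (F : SGD.E d → ℝ) (μ : ℝ) (hF : SGD.ObjectiveAssumption F μ) :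
    (∃! xs : SGD.E d, ∀ y, F xs ≤ F y) ∧
    ∀ xs : SGD.E d, (∀ y, F xs ≤ F y) →
    ∀ σ : ℝ → SGD.E d → Matrix (Fin d) (Fin d) ℝ, SGD.DiffusionAssumption σ xs →
    ∀ hmax : ℝ, 0 < hmax →
    ∃ H C : ℝ, 0 < H ∧ H < hmax ∧ 0 < C ∧
      ∀ (Ω : Type*) [MeasurableSpace Ω] (P : Measure Ω) [IsProbabilityMeasure P]
        (γ : ℕ → Ω → SGD.E d),
        (∀ n : ℕ, HasLaw (γ (n + 1)) (stdGaussian (SGD.E d)) P) →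
        iIndepFun (fun n : ℕ => γ (n + 1)) P →
      ∀ φ : SGD.E d → ℝ, ContDiff ℝ 2 φ →
        (∃ M : ℝ, ∀ x, ‖iteratedFDeriv ℝ 2 φ x‖ ≤ M) →
      ∀ (x₀ : SGD.E d) (N : ℕ), 1 ≤ N → ∀ h : ℝ, 0 < h → h < H →
        Integrable (fun ω => φ (SGD.scheme F σ γ h x₀ N ω)) P ∧
        |(∫ ω, φ (SGD.scheme F σ γ h x₀ N ω) ∂P) - φ xs|
          ≤ C * (‖∇ φ xs‖ + SGD.tripleNorm 2 φ) * (1 + ‖x₀ - xs‖ ^ 3)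
            * (Real.exp (-μ * N * h) + h) := by

  refine ⟨hF.existsUnique_minimizer, fun xs hxs σ hσ hmax hmax0 => ?_⟩
  obtain ⟨H, c, C, hH0, hHmax, hc, hC, hmom⟩ := SGD.exists_moments_bound hF hxs hσ hmax0
  refine ⟨H, 1 + c + C, hH0, hHmax, by linarith, ?_⟩
  intro Ω _ P _ γ hγ hind φ hφ hφb x₀ N _ h hh hhH
  obtain ⟨hmem, hbound⟩ := hmom Ω P γ hγ hind x₀ N h hh hhH
  obtain ⟨hint, habs⟩ := SGD.integrable_and_abs_integral_sub_le hφ hφb hmem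
  refine ⟨hint, habs.trans ?_⟩
  have hT0 : 0 ≤ SGD.tripleNorm 2 φ := Real.iSup_nonneg fun x => norm_nonneg _
  set T := SGD.tripleNorm 2 φ
  set m := ‖∫ ω, SGD.scheme F σ γ h x₀ N ω - xs ∂P‖
  set a := ∫ ω, ‖SGD.scheme F σ γ h x₀ N ω - xs‖ ^ 2 ∂P
  have ha0 : 0 ≤ a := integral_nonneg fun ω => sq_nonneg _
  have hm0 : 0 ≤ m := norm_nonneg _
  set ρ := ‖x₀ - xs‖
  have hρ0 : 0 ≤ ρ := norm_nonneg _
  -- The moments grow only quadratically in `ρ`; the cubic weight of the statement dominates both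
  -- `ρ` and `ρ ^ 2`.
  have hρ1 : ρ ≤ 1 + ρ ^ 3 := by
    nlinarith [mul_nonneg hρ0 (sq_nonneg (ρ - 1)), sq_nonneg (ρ - 1)]
  have hρ2 : ρ ^ 2 ≤ 1 + ρ ^ 3 := by
    nlinarith [mul_nonneg hρ0 (sq_nonneg (ρ - 1)), sq_nonneg (ρ - 1)]
  set e := Real.exp (-μ * N * h)
  have he0 : 0 < e := Real.exp_pos _
  have hac : a ≤ c * a := le_mul_of_one_le_left ha0 hc
  have hρ3 : 0 ≤ ρ ^ 3 := by positivity
  calc ‖∇ φ xs‖ * m + T * a ≤ ‖∇ φ xs‖ * (m + c * a) + T * (m + c * a) := by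
        gcongr <;> linarith
    _ = (‖∇ φ xs‖ + T) * (m + c * a) := by ring
    _ ≤ (‖∇ φ xs‖ + T) * (e * (ρ + c * ρ ^ 2) + C * h) := by gcongr
    _ ≤ (‖∇ φ xs‖ + T) * ((1 + c + C) * (1 + ρ ^ 3) * (e + h)) := by
        gcongr
        have h1 : ρ + c * ρ ^ 2 ≤ (1 + c) * (1 + ρ ^ 3) := by nlinarith
        have h2 := mul_le_mul_of_nonneg_left h1 he0.le
        have h3 : 0 ≤ C * (1 + ρ ^ 3) * e := by positivity
        have h4 : 0 ≤ (1 + c) * (1 + ρ ^ 3) * h := by positivity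
        have h5 : 0 ≤ C * h * ρ ^ 3 := by positivity
        nlinarith
    _ = _ := by ring
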